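/- **Problem.** An instance consists of a set $\mathcal A$ of $n$ agents, a (simple, undirected) graph $\mathcal G$ on $\mathcal A$, a set $\mathcal H$ of $m$ houses, and for every agent $a$ a set $\mathcal P_a\subseteq\mathcal H$ of preferred houses. An *allocation* is an injective map $\phi:\mathcal A\to\mathcal H$. Under $\phi$, agent $a$ is *envious* if $\phi(a)\notin\mathcal P_a$ and $\phi(a')\in\mathcal P_a$ for some neighbour $a'$ of $a$ in $\mathcal G$, and $a$ is *happy* if $\phi(a)\in\mathcal P_a$. The *envy* and the *happiness* of $\phi$ are the numbers of envious and of happy agents. The problem Optimally Happy House Allocation of Agent Network asks for an allocation that has minimum envy among all allocations and, among all minimum-envy allocations, has maximum happiness; call such an allocation *optimally happy*. **Statement.** There is a polynomial-time algorithm for Optimally Happy House Allocation of Agent Network when every agent likes exactly one house: there are an algorithm (a single random access machine program with addition and truncated subtraction, each instruction counted as one step) and a polynomial $p$ such that on every instance with $n\le m$ and $|\mathcal P_a|=1$ for all $a\in\mathcal A$, given as $n$, $m$, the adjacency matrix of $\mathcal G$ and the $0/1$ matrix of the preferences, the algorithm halts after at most $p(n+m)$ steps and outputs an optimally happy allocation.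 Moreover, on every instance with $|\mathcal P_a|=1$ for all $a\in\mathcal A$, put, for $a\in\mathcal A$ and $h\in\mathcal H$, $$w(a,h)=\bigl|\{a'\in N_{\mathcal G}(a): \mathcal P_{a'}=\{h\}\}\bigr|-\begin{cases}\frac1{n+1}&\text{if }h\in\mathcal P_a,\\0&\text{if }h\notin\mathcal P_a.\end{cases}$$ Then for every allocation $\phi$, the matching $\{\{a,\phi(a)\}:a\in\mathcal A\}$ in the complete bipartite graph between $\mathcal A$ and $\mathcal H$ has cost $\sum_{a\in\mathcal A}w(a,\phi(a))=\alpha-\beta\cdot\frac1{n+1}$, where $\alpha$ is the envy and $\beta$ the happiness of $\phi$; and $\phi$ is optimally happy if and only if this cost is minimum among all allocations. -/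

import Mathlib

/-! ### House allocation on an agent network -/

namespace HouseAllocation

/-- An instance: agents `Fin n`, houses `Fin m`, an agent graph `G`, and for every agent `a` the
set `pref a` of the houses that `a` prefers. -/
structure Network where
  n : ℕ
  m : ℕ
  G : SimpleGraph (Fin n)
  pref : Fin n → Finset (Fin m)

namespace Network

/-- An allocation is an injective function from agents to houses. -/
abbrev Allocation (I : Network) : Type := Fin I.n ↪ Fin I.m

/-- The set of neighbours whom agent `a` envies under `φ`. -/
def enviedBy (I : Network) (φ : I.Allocation) (a : Fin I.n) : Set (Fin I.n) :=
  {a' | I.G.Adj a a' ∧ φ a ∉ I.pref a ∧ φ a' ∈ I.pref a}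

/-- The envy of an allocation: the number of envious agents. -/
noncomputable def envy (I : Network) (φ : I.Allocation) : ℕ :=
  {a | (I.enviedBy φ a).Nonempty}.ncard

/-- The happiness of an allocation: the number of happy agents. -/
noncomputable def happiness (I : Network) (φ : I.Allocation) : ℕ :=
  {a | φ a ∈ I.pref a}.ncard

def IsMinEnvy (I : Network) (φ : I.Allocation) : Prop :=
  ∀ ψ : I.Allocation, I.envy φ ≤ I.envy ψ

/-- `φ` is a solution of the optimally happy problem: it has minimum envy and, among all
minimum-envy allocations, maximum happiness. -/
def IsOptimallyHappy (I : Network) (φ : I.Allocation) : Prop :=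
  I.IsMinEnvy φ ∧ ∀ ψ : I.Allocation, I.IsMinEnvy ψ → I.happiness ψ ≤ I.happiness φ

/-- The perturbed weight of the edge between agent `a` and house `h` in the complete bipartite
graph between agents and houses. -/
noncomputable def weight (I : Network) (a : Fin I.n) (h : Fin I.m) : ℚ :=
  ({a' | I.G.Adj a a' ∧ I.pref a' = {h}}.ncard : ℚ) -
    (if h ∈ I.pref a then 1 / ((I.n : ℚ) + 1) else 0)

/-- The cost of the matching `{(a, φ a)}` that corresponds to the allocation `φ`. -/
noncomputable def cost (I : Network) (φ : I.Allocation) : ℚ :=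
  ∑ a, I.weight a (φ a)

open Classical in
/-- The input given to an algorithm: the numbers `n` and `m`, then the `n × n` adjacency matrix of
the graph, then the `n × m` membership matrix of the preferences, both with entries `0`, `1` and
in row-major order. -/
noncomputable def encode (I : Network) : List ℕ :=
  [I.n, I.m] ++
    (List.ofFn fun k : Fin (I.n * I.n) => if I.G.Adj k.divNat k.modNat then 1 else 0) ++
    (List.ofFn fun k : Fin (I.n * I.m) => if k.modNat ∈ I.pref k.divNat then 1 else 0)

end Network

end HouseAllocation

/-! ### Random access machine programs with a step count -/

namespace RAM

/-- The memory of the machine: registers and arrays (each with random access), all of whose cells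
hold natural numbers. -/
structure State where
  reg : ℕ → ℕ
  arr : ℕ → ℕ → ℕ

/-- Overwrite register `i`. -/
def State.setReg (s : State) (i v : ℕ) : State :=
  { s with reg := Function.update s.reg i v }

/-- Overwrite cell `k` of array `b`. -/
def State.setArr (s : State) (b k v : ℕ) : State :=
  { s with arr := Function.update s.arr b (Function.update (s.arr b) k v) }

/-- Programs. The indices of registers and arrays are fixed in the text of the program, so that a
program uses finitely many of them; only the position inside an array is computed at run time. The
arithmetic is addition and truncated subtraction; there is no multiplication, so that in `t` steps
the bit length of the numbers grows by at most `t` (up to a constant depending on the program), and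
running times agree with those of Turing machines up to a polynomial. -/
inductive Program where
  | skip : Program
  /-- `reg i := c` -/
  | const (i c : ℕ) : Program
  /-- `reg i := reg j + reg k` -/
  | add (i j k : ℕ) : Program
  /-- `reg i := reg j - reg k` (truncated) -/
  | sub (i j k : ℕ) : Program
  /-- `reg i := arr b [reg j]` -/
  | load (i b j : ℕ) : Program
  /-- `arr b [reg i] := reg j` -/
  | store (b i j : ℕ) : Program
  /-- `P; Q` -/
  | seq (P Q : Program) : Program
  /-- if `reg i ≠ 0` then `P` else `Q` -/
  | branch (i : ℕ) (P Q : Program) : Program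
  /-- while `reg i ≠ 0` do `P` -/
  | loop (i : ℕ) (P : Program) : Program

/-- `Exec P s t s'`: started in state `s`, the program `P` halts in state `s'` after exactly `t`
steps. Every elementary instruction and every evaluation of a test is one step. -/
inductive Exec : Program → State → ℕ → State → Prop where
  | skip (s : State) : Exec .skip s 1 s
  | const (s : State) (i c : ℕ) : Exec (.const i c) s 1 (s.setReg i c)
  | add (s : State) (i j k : ℕ) : Exec (.add i j k) s 1 (s.setReg i (s.reg j + s.reg k))
  | sub (s : State) (i j k : ℕ) : Exec (.sub i j k) s 1 (s.setReg i (s.reg j - s.reg k))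
  | load (s : State) (i b j : ℕ) : Exec (.load i b j) s 1 (s.setReg i (s.arr b (s.reg j)))
  | store (s : State) (b i j : ℕ) : Exec (.store b i j) s 1 (s.setArr b (s.reg i) (s.reg j))
  | seq {P Q : Program} {s s' s'' : State} {t t' : ℕ} :
      Exec P s t s' → Exec Q s' t' s'' → Exec (.seq P Q) s (t + t') s''
  | branch_pos {i : ℕ} {P Q : Program} {s s' : State} {t : ℕ} :
      s.reg i ≠ 0 → Exec P s t s' → Exec (.branch i P Q) s (t + 1) s'
  | branch_zero {i : ℕ} {P Q : Program} {s s' : State} {t : ℕ} :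
      s.reg i = 0 → Exec Q s t s' → Exec (.branch i P Q) s (t + 1) s'
  | loop_done {i : ℕ} {P : Program} {s : State} :
      s.reg i = 0 → Exec (.loop i P) s 1 s
  | loop_step {i : ℕ} {P : Program} {s s' s'' : State} {t t' : ℕ} :
      s.reg i ≠ 0 → Exec P s t s' → Exec (.loop i P) s' t' s'' →
        Exec (.loop i P) s (t + t' + 1) s''

/-- Execution is deterministic: the number of steps and the final state are determined by the
program and the initial state. -/
theorem Exec.deterministic {P : Program} {s s₁ s₂ : State} {t₁ t₂ : ℕ}
    (h₁ : Exec P s t₁ s₁) (h₂ : Exec P s t₂ s₂) : t₁ = t₂ ∧ s₁ = s₂ := by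
  induction h₁ generalizing t₂ s₂ with
  | seq _ _ ih ih' =>
    cases h₂ with
    | seq g g' =>
      obtain ⟨rfl, rfl⟩ := ih g
      obtain ⟨rfl, rfl⟩ := ih' g'
      exact ⟨rfl, rfl⟩
  | branch_pos h _ ih =>
    cases h₂ with
    | branch_pos _ g =>
      obtain ⟨rfl, rfl⟩ := ih g
      exact ⟨rfl, rfl⟩
    | branch_zero h' _ => exact absurd h' h
  | branch_zero h _ ih =>
    cases h₂ with
    | branch_pos h' _ => exact absurd h h'
    | branch_zero _ g =>
      obtain ⟨rfl, rfl⟩ := ih g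
      exact ⟨rfl, rfl⟩
  | loop_done h =>
    cases h₂ with
    | loop_done _ => exact ⟨rfl, rfl⟩
    | loop_step h' _ _ => exact absurd h h'
  | loop_step h _ _ ih ih' =>
    cases h₂ with
    | loop_done h' => exact absurd h' h
    | loop_step _ g g' =>
      obtain ⟨rfl, rfl⟩ := ih g
      obtain ⟨rfl, rfl⟩ := ih' g'
      exact ⟨rfl, rfl⟩
  | _ => cases h₂; exact ⟨rfl, rfl⟩

/-- The initial state: array `0` holds the input, everything else is `0`. -/
def init (input : List ℕ) : State where
  reg := fun _ => 0
  arr := fun b k => if b = 0 then input.getD k 0 else 0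

end RAM

namespace HouseAllocation

/-- Given the instance `I`, the program `P` halts after at most `T` steps, and the first `n` cells
of array `1` then hold an optimally happy allocation of `I`. -/
def SolvesWithin (P : RAM.Program) (I : Network) (T : ℕ) : Prop :=
  ∃ (t : ℕ) (s : RAM.State), RAM.Exec P (RAM.init I.encode) t s ∧ t ≤ T ∧
    ∃ φ : I.Allocation, (∀ a : Fin I.n, s.arr 1 (a : ℕ) = (φ a : ℕ)) ∧ I.IsOptimallyHappy φ

end HouseAllocation

/-! Fix an agent `a'` with its only liked house `h`. By injectivity at most one agent holds `h`, and
`a'` is envious exactly when that holder is a neighbour of `a'`. Charging each envy to the holder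
makes it a sum of edge weights, so the envy is additive over the matching. At most `n` agents are
happy, so a reward of `1/(n+1)` per happy agent only breaks ties between equal envies. This gives
`cost_eq` and `isOptimallyHappy_iff`: optimal happiness is a minimum-cost assignment problem.

The algorithm is an auction with unit price increments on costs scaled to natural numbers. An
unassigned agent takes a house that minimizes cost plus price, raises its price by one and displaces
the owner. Every assigned agent then holds a best house up to `1` (`AuctionInv.bid`). Unowned houses
keep price `0`, so the final assignment is optimal up to `n` in total (`AuctionInv.optimal`). Up to
a common shift, scaled costs of allocations are multiples of `n + 1 > n`, so the result is exactly
optimal (`solvesWithin_auction`).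

While an agent is unassigned there is a free house of price `0`, so prices stay polynomially
bounded. Each bid raises their sum by one, which bounds the number of bids (`runs_auction`). -/

namespace RAM

/-! ### Program logic for total correctness with step counts -/

/-- Started in state `s`, the program `P` halts, and the number of steps and the final state
satisfy `Q`. -/
def Runs (P : Program) (s : State) (Q : ℕ → State → Prop) : Prop :=
  ∃ t s', Exec P s t s' ∧ Q t s'

@[simp] theorem State.setReg_reg (s : State) (i v j : ℕ) :
    (s.setReg i v).reg j = if j = i then v else s.reg j := by
  simp [State.setReg, Function.update_apply]

@[simp] theorem State.setReg_arr (s : State) (i v : ℕ) : (s.setReg i v).arr = s.arr := rfl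

@[simp] theorem State.setArr_reg (s : State) (b k v : ℕ) : (s.setArr b k v).reg = s.reg := rfl

@[simp] theorem State.setArr_arr (s : State) (b k v c : ℕ) :
    (s.setArr b k v).arr c = if c = b then Function.update (s.arr b) k v else s.arr c := by
  by_cases h : c = b
  · subst h; simp [State.setArr]
  · simp [State.setArr, h]

namespace Runs

variable {P P' : Program} {s : State} {Q Q' : ℕ → State → Prop}

theorem mono (h : Runs P s Q) (hQ : ∀ t s', Q t s' → Q' t s') : Runs P s Q' := by
  obtain ⟨t, s', he, hq⟩ := h
  exact ⟨t, s', he, hQ t s' hq⟩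

theorem skip_iff : Runs .skip s Q ↔ Q 1 s :=
  ⟨fun ⟨_, _, he, hq⟩ => by cases he; exact hq, fun h => ⟨_, _, .skip s, h⟩⟩

theorem const_iff {i c : ℕ} : Runs (.const i c) s Q ↔ Q 1 (s.setReg i c) :=
  ⟨fun ⟨_, _, he, hq⟩ => by cases he; exact hq, fun h => ⟨_, _, .const s i c, h⟩⟩

theorem add_iff {i j k : ℕ} :
    Runs (.add i j k) s Q ↔ Q 1 (s.setReg i (s.reg j + s.reg k)) :=
  ⟨fun ⟨_, _, he, hq⟩ => by cases he; exact hq, fun h => ⟨_, _, .add s i j k, h⟩⟩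

theorem sub_iff {i j k : ℕ} :
    Runs (.sub i j k) s Q ↔ Q 1 (s.setReg i (s.reg j - s.reg k)) :=
  ⟨fun ⟨_, _, he, hq⟩ => by cases he; exact hq, fun h => ⟨_, _, .sub s i j k, h⟩⟩

theorem load_iff {i b j : ℕ} :
    Runs (.load i b j) s Q ↔ Q 1 (s.setReg i (s.arr b (s.reg j))) :=
  ⟨fun ⟨_, _, he, hq⟩ => by cases he; exact hq, fun h => ⟨_, _, .load s i b j, h⟩⟩

theorem store_iff {b i j : ℕ} :
    Runs (.store b i j) s Q ↔ Q 1 (s.setArr b (s.reg i) (s.reg j)) :=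
  ⟨fun ⟨_, _, he, hq⟩ => by cases he; exact hq, fun h => ⟨_, _, .store s b i j, h⟩⟩

theorem seq_iff :
    Runs (.seq P P') s Q ↔ Runs P s fun t s' => Runs P' s' fun t' s'' => Q (t + t') s'' := by
  constructor
  · rintro ⟨_, _, he, hq⟩
    cases he with
    | seq h h' => exact ⟨_, _, h, _, _, h', hq⟩
  · rintro ⟨_, _, h, _, _, h', hq⟩
    exact ⟨_, _, .seq h h', hq⟩

theorem branch_iff {i : ℕ} :
    Runs (.branch i P P') s Q ↔
      if s.reg i = 0 then Runs P' s fun t => Q (t + 1) else Runs P s fun t => Q (t + 1) := by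
  split_ifs with h0
  · constructor
    · rintro ⟨_, _, he, hq⟩
      cases he with
      | branch_pos h _ => exact absurd h0 h
      | branch_zero _ h => exact ⟨_, _, h, hq⟩
    · rintro ⟨_, _, h, hq⟩
      exact ⟨_, _, .branch_zero h0 h, hq⟩
  · constructor
    · rintro ⟨_, _, he, hq⟩
      cases he with
      | branch_pos _ h => exact ⟨_, _, h, hq⟩
      | branch_zero h _ => exact absurd h h0
    · rintro ⟨_, _, h, hq⟩
      exact ⟨_, _, .branch_pos h0 h, hq⟩

/-- The total correctness rule for loops: `I` is an invariant, `μ` a variant, and every round takes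
at most `B` steps. -/
theorem loop {i : ℕ} (μ : State → ℕ) (B : ℕ) (I : State → Prop)
    (step : ∀ s, I s → s.reg i ≠ 0 → Runs P s fun t s' => t ≤ B ∧ I s' ∧ μ s' < μ s)
    (hs : I s) :
    Runs (.loop i P) s fun t s' => t ≤ μ s * (B + 1) + 1 ∧ I s' ∧ s'.reg i = 0 := by
  induction hk : μ s using Nat.strong_induction_on generalizing s with
  | _ k ih =>
    subst hk
    by_cases h0 : s.reg i = 0
    · exact ⟨_, _, .loop_done h0, by omega, hs, h0⟩
    · obtain ⟨t, s', he, ht, hI, hμ⟩ := step s hs h0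
      obtain ⟨t', s'', he', ht', hI', h0'⟩ := ih _ hμ hI rfl
      refine ⟨_, _, .loop_step h0 he he', ?_, hI', h0'⟩
      calc t + t' + 1 ≤ B + (μ s' * (B + 1) + 1) + 1 := by omega
        _ = (μ s' + 1) * (B + 1) + 1 := by ring
        _ ≤ μ s * (B + 1) + 1 := by gcongr; exact hμ

/-- The rule for loops whose counter counts down from `N`. -/
theorem loop_count {i : ℕ} (N B : ℕ) (I : ℕ → State → Prop)
    (hreg : ∀ k s, I k s → s.reg i = N - k)
    (step : ∀ k < N, ∀ s, I k s → Runs P s fun t s' => t ≤ B ∧ I (k + 1) s')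
    (hs : I 0 s) :
    Runs (.loop i P) s fun t s' => t ≤ N * (B + 1) + 1 ∧ I N s' := by
  have key := loop (P := P) (i := i) (s := s) (fun s => s.reg i) B (fun s => ∃ k ≤ N, I k s) ?_
    ⟨0, Nat.zero_le _, hs⟩
  · refine key.mono ?_
    rintro t s' ⟨ht, ⟨k, hk, hI⟩, h0⟩
    rw [hreg 0 s hs] at ht
    have := hreg k s' hI
    -- The counter is `0`, so `N - k = 0`; together with `k ≤ N` this excludes overshooting.
    obtain rfl : k = N := by omega
    exact ⟨by simpa using ht, hI⟩
  · rintro s ⟨k, hk, hI⟩ h0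
    have hk' := hreg k s hI
    refine (step k (by omega) s hI).mono ?_
    rintro t s' ⟨ht, hI'⟩
    have := hreg _ s' hI'
    exact ⟨ht, ⟨k + 1, by omega, hI'⟩, by omega⟩

end Runs

/-- `reg i := reg j * reg k`, provided that `reg 2 = 1`; register `20` is overwritten. -/
def Program.mul (i j k : ℕ) : Program :=
  .seq (.const i 0) <| .seq (.add 20 i k) <| .loop 20 (.seq (.add i i j) (.sub 20 20 2))

/-- Register `i` is zeroed first, so the addition into register `20` copies the factor `reg k` as
loop counter. The case `j = k` is allowed, for squaring. -/
theorem Runs.mul {s : State} {i j k : ℕ} (hone : s.reg 2 = 1) (hij : i ≠ j) (hik : i ≠ k)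
    (hi : i ≠ 2) (hi' : i ≠ 20) (hj : j ≠ 20) (N : ℕ) (hN : s.reg k ≤ N) :
    Runs (.mul i j k) s fun t s' => t ≤ 3 * N + 3 ∧ s'.arr = s.arr ∧
      s'.reg i = s.reg j * s.reg k ∧ ∀ r, r ≠ i → r ≠ 20 → s'.reg r = s.reg r := by
  simp only [Program.mul, Runs.seq_iff, Runs.const_iff, Runs.add_iff]
  refine (Runs.loop_count (s.reg k) 2 (fun l s' => s'.reg 20 = s.reg k - l ∧ s'.arr = s.arr ∧
      s'.reg i = s.reg j * l ∧ ∀ r, r ≠ i → r ≠ 20 → s'.reg r = s.reg r) ?_ ?_ ?_).mono ?_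
  · exact fun _ _ h => h.1
  · rintro l hl s' ⟨h1, h2, h3, h4⟩
    have h5 := h4 2 hi.symm (by decide)
    have h6 := h4 j hij.symm hj
    simp only [Runs.seq_iff, Runs.add_iff, Runs.sub_iff]
    refine ⟨le_rfl, ?_, h2, ?_, ?_⟩
    · simp [hi.symm, hi'.symm, h1, h5, hone]; omega
    · simp [hi', h3, h6]; ring
    · intro r hr hr'
      simp [hr, hr', h4 r hr hr']
  · refine ⟨?_, rfl, ?_, ?_⟩
    · simp [hik.symm]
    · simp [hi']
    · intro r hr hr'
      simp [hr, hr']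
  · rintro t s' ⟨ht, -, h2, h3, h4⟩
    exact ⟨by omega, h2, h3, h4⟩

end RAM

/-! ### The auction as a mathematical process -/

namespace HouseAllocation

/-- The invariant of the auction with unit price increments: `φ` assigns the agents up to `next`
other than `cur`, the array `own` stores for every house the successor of its owner (or `0`), and
`p` stores the prices, for which every assigned agent has a best house up to `1`. -/
structure AuctionInv (n m C : ℕ) (c : ℕ → ℕ → ℕ) (φ p own : ℕ → ℕ) (cur next : ℕ) : Prop where
  cur_le : cur ≤ next
  next_le : next ≤ n
  cur_eq : next = n → cur = n
  own_apply : ∀ a ≤ next, a ≠ cur → φ a < m ∧ own (φ a) = a + 1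
  apply_own : ∀ h < m, ∀ a, own h = a + 1 → a ≤ next ∧ a ≠ cur ∧ φ a = h
  price_free : ∀ h < m, own h = 0 → p h = 0
  slack : ∀ a ≤ next, a ≠ cur → ∀ h < m, c a (φ a) + p (φ a) ≤ c a h + p h + 1
  price_le : ∀ h < m, p h ≤ C + 1

namespace AuctionInv

variable {n m C : ℕ} {c : ℕ → ℕ → ℕ} {φ p own : ℕ → ℕ} {cur next : ℕ}

theorem initial (hn : 0 < n) (hφ : ∀ h, own h = 0) (hp : ∀ h, p h = 0) :
    AuctionInv n m C c φ p own 0 0 where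
  cur_le := le_rfl
  next_le := by omega
  cur_eq := by omega
  own_apply a h h' := by omega
  apply_own h _ a ha := by simp [hφ] at ha
  price_free h _ _ := hp h
  slack a h h' := by omega
  price_le h _ := by simp [hp]

/-- Otherwise mapping each house to its owner would inject `m` houses into the at most `n - 1`
agents other than `cur`. -/
theorem exists_free (hI : AuctionInv n m C c φ p own cur next) (hnm : n ≤ m) (hcur : cur < n) :
    ∃ h < m, own h = 0 := by
  by_contra! hne
  have hnext : next < n := lt_of_le_of_ne hI.next_le fun h => by have := hI.cur_eq h; omega
  have key : ∀ h < m, own h - 1 ≤ next ∧ own h - 1 ≠ cur ∧ φ (own h - 1) = h := fun h hh =>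
    hI.apply_own h hh _ (by have := hne h hh; omega)
  have : (Finset.range m).card ≤ ((Finset.range n).erase cur).card := by
    refine Finset.card_le_card_of_injOn (fun h => own h - 1) ?_ ?_
    · intro h hh
      have := key h (by simpa using hh)
      simp only [Finset.coe_erase, Set.mem_sdiff, Finset.coe_range, Set.mem_Iio,
        Set.mem_singleton_iff]
      omega
    · intro h hh h' hh' heq
      rw [← (key h (by simpa using hh)).2.2, ← (key h' (by simpa using hh')).2.2]
      exact congrArg φ heq
  rw [Finset.card_erase_of_mem (by simpa using hcur)] at this
  simp only [Finset.card_range] at this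
  omega

/-- The invariant survives a bid of agent `cur` for a best house `b`. -/
theorem bid (hI : AuctionInv n m C c φ p own cur next) (hnm : n ≤ m) (hcur : cur < n)
    (hc : ∀ a < n, ∀ h < m, c a h ≤ C) {b : ℕ} (hb : b < m)
    (hbest : ∀ h < m, c cur b + p b ≤ c cur h + p h) :
    (∀ a, own b = a + 1 → AuctionInv n m C c (Function.update φ cur b)
      (Function.update p b (p b + 1)) (Function.update own b (cur + 1)) a next) ∧
    (own b = 0 → AuctionInv n m C c (Function.update φ cur b)
      (Function.update p b (p b + 1)) (Function.update own b (cur + 1)) (next + 1) (next + 1)) := by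
  have hnext : next < n := lt_of_le_of_ne hI.next_le fun h => by have := hI.cur_eq h; omega
  have hcn := hI.cur_le
  -- The best house is compared with a free house of price `0`, hence cost at most `C`; so `p b ≤ C`
  -- before the bid.
  have hprice : ∀ h < m, Function.update p b (p b + 1) h ≤ C + 1 := by
    intro h hh
    rcases eq_or_ne h b with rfl | hne
    · obtain ⟨f, hf, hf0⟩ := hI.exists_free hnm hcur
      have h1 := hbest f hf
      rw [hI.price_free f hf hf0] at h1
      have h2 := hc cur hcur f hf
      simp only [Function.update_self]
      omega
    · simpa [hne] using hI.price_le h hh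
  have hmono : ∀ h, p h ≤ Function.update p b (p b + 1) h := by
    intro h
    rcases eq_or_ne h b with rfl | hne
    · simp
    · simp [hne]
  have hfree : ∀ h < m, Function.update own b (cur + 1) h = 0 →
      Function.update p b (p b + 1) h = 0 := by
    intro h hh h0
    rcases eq_or_ne h b with rfl | hne
    · simp at h0
    · simp only [ne_eq, hne, not_false_eq_true, Function.update_of_ne] at h0 ⊢
      exact hI.price_free h hh h0
  -- The unit slack absorbs the bidder's own increment; for the other agents, rising prices
  -- elsewhere only help.
  have hcurslack : ∀ h < m, c cur b + (p b + 1) ≤ c cur h + Function.update p b (p b + 1) h + 1 := by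
    intro h hh
    have h1 := hbest h hh
    have h2 := hmono h
    omega
  have hslack : ∀ a ≤ next, a ≠ cur → ∀ h < m,
      c a (φ a) + p (φ a) ≤ c a h + Function.update p b (p b + 1) h + 1 := by
    intro a ha hac h hh
    have h1 := hI.slack a ha hac h hh
    have h2 := hmono h
    omega
  constructor
  · intro k hk
    obtain ⟨hk1, hk2, hk3⟩ := hI.apply_own b hb k hk
    have hne : ∀ a ≤ next, a ≠ k → a ≠ cur → φ a ≠ b := by
      intro a ha hak hac h
      have := (hI.own_apply a ha hac).2
      rw [h] at this
      omega
    refine ⟨hk1, hI.next_le, by omega, ?_, ?_, hfree, ?_, hprice⟩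
    · intro a ha hak
      rcases eq_or_ne a cur with rfl | hac
      · simp [hb]
      · simpa [hac, hne a ha hak hac] using hI.own_apply a ha hac
    · intro h hh a ha
      rcases eq_or_ne h b with rfl | hhb
      · simp only [Function.update_self, Nat.add_right_cancel_iff] at ha
        subst ha
        exact ⟨hcn, hk2.symm, by simp⟩
      · simp only [ne_eq, hhb, not_false_eq_true, Function.update_of_ne] at ha
        obtain ⟨h1, h2, h3⟩ := hI.apply_own h hh a ha
        refine ⟨h1, ?_, by simpa [h2] using h3⟩
        rintro rfl
        exact hhb (h3.symm.trans hk3)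
    · intro a ha hak h hh
      rcases eq_or_ne a cur with rfl | hac
      · simpa using hcurslack h hh
      · simpa [hac, hne a ha hak hac] using hslack a ha hac h hh
  · intro h0
    have hne : ∀ a ≤ next, a ≠ cur → φ a ≠ b := by
      intro a ha hac h
      have := (hI.own_apply a ha hac).2
      rw [h] at this
      omega
    refine ⟨le_rfl, hnext, id, ?_, ?_, hfree, ?_, hprice⟩
    · intro a ha hak
      have ha' : a ≤ next := by omega
      rcases eq_or_ne a cur with rfl | hac
      · simp [hb]
      · simpa [hac, hne a ha' hac] using hI.own_apply a ha' hac
    · intro h hh a ha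
      rcases eq_or_ne h b with rfl | hhb
      · simp only [Function.update_self, Nat.add_right_cancel_iff] at ha
        subst ha
        exact ⟨by omega, by omega, by simp⟩
      · simp only [ne_eq, hhb, not_false_eq_true, Function.update_of_ne] at ha
        obtain ⟨h1, h2, h3⟩ := hI.apply_own h hh a ha
        exact ⟨by omega, by omega, by simpa [h2] using h3⟩
    · intro a ha hak h hh
      have ha' : a ≤ next := by omega
      rcases eq_or_ne a cur with rfl | hac
      · simpa using hcurslack h hh
      · simpa [hac, hne a ha' hac] using hslack a ha' hac h hh

/-- When all agents are assigned, the assignment is optimal up to `1` per agent. -/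
theorem optimal (hI : AuctionInv n m C c φ p own cur next) (hcur : n ≤ cur) :
    ∃ ψ : Fin n ↪ Fin m, (∀ a : Fin n, φ a = ψ a) ∧
      ∀ χ : Fin n ↪ Fin m, ∑ a : Fin n, c a (ψ a) ≤ ∑ a : Fin n, c a (χ a) + n := by
  have h1 := hI.cur_le
  have h2 := hI.next_le
  have hA : ∀ a : Fin n, (a : ℕ) ≤ next ∧ (a : ℕ) ≠ cur := fun a => by have := a.2; omega
  have hown : ∀ a : Fin n, φ a < m ∧ own (φ a) = a + 1 := fun a =>
    hI.own_apply a (hA a).1 (hA a).2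
  let ψ : Fin n ↪ Fin m := ⟨fun a => ⟨φ a, (hown a).1⟩, fun a b hab => by
    have hab' : φ a = φ b := by simpa using hab
    have ha := (hown a).2
    rw [hab', (hown b).2] at ha
    exact Fin.ext (by omega)⟩
  refine ⟨ψ, fun a => rfl, fun χ => ?_⟩
  have hsum : ∀ χ : Fin n ↪ Fin m,
      ∑ a, p (χ a) = ∑ h ∈ Finset.univ.map χ, p (h : ℕ) := fun χ => by
    rw [Finset.sum_map]
  -- Unowned houses have price `0`, so the assigned houses carry the whole price sum, and no other
  -- allocation can carry more.
  have hall : ∑ a, p (ψ a) = ∑ h : Fin m, p h := by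
    rw [hsum]
    refine Finset.sum_subset (Finset.subset_univ _) fun h _ hh => ?_
    refine hI.price_free h h.2 ?_
    by_contra h0
    obtain ⟨k, hk⟩ := Nat.exists_eq_succ_of_ne_zero h0
    obtain ⟨hk1, hk2, hk3⟩ := hI.apply_own h h.2 k hk
    refine hh (Finset.mem_map.2 ⟨⟨k, by omega⟩, Finset.mem_univ _, Fin.ext hk3⟩)
  have hle : ∑ a, p (χ a) ≤ ∑ a, p (ψ a) := by
    rw [hall, hsum]
    exact Finset.sum_le_sum_of_subset (Finset.subset_univ _)
  have hmain : ∑ a : Fin n, (c a (ψ a) + p (ψ a)) ≤ ∑ a : Fin n, (c a (χ a) + p (χ a) + 1) :=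
    Finset.sum_le_sum fun a _ => hI.slack a (hA a).1 (hA a).2 (χ a) (χ a).2
  simp only [Finset.sum_add_distrib, Finset.sum_const, Finset.card_univ, Fintype.card_fin,
    smul_eq_mul, mul_one] at hmain
  omega

end AuctionInv

end HouseAllocation

/-! ### The auction as a program, with its running time -/

namespace HouseAllocation

open RAM RAM.Program

/-- The scaled cost of assigning house `h` to agent `a`, read off from the input array `x`. -/
def inputCost (x : ℕ → ℕ) (n m a h : ℕ) : ℕ :=
  (n + 1) * (n + 1) *
      Nat.count (fun a' => x (2 + a * n + a') ≠ 0 ∧ x (2 + n * n + (a' * m + h)) ≠ 0) n +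
    if x (2 + n * n + (a * m + h)) = 0 then n + 1 else 0

theorem inputCost_le (x : ℕ → ℕ) (n m a h : ℕ) : inputCost x n m a h ≤ (n + 1) ^ 3 := by
  have h1 : Nat.count (fun a' => x (2 + a * n + a') ≠ 0 ∧ x (2 + n * n + (a' * m + h)) ≠ 0) n ≤ n :=
    Nat.count_le _
  have h2 : (if x (2 + n * n + (a * m + h)) = 0 then n + 1 else 0) ≤ (n + 1) * (n + 1) := by
    split_ifs
    · nlinarith
    · positivity
  calc inputCost x n m a h ≤ (n + 1) * (n + 1) * n + (n + 1) * (n + 1) := by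
        unfold inputCost; gcongr
    _ = (n + 1) ^ 3 := by ring

/-- The registers `0, …, 5` hold the constants of the auction, and the array `0` the input `x`. -/
structure Ready (x : ℕ → ℕ) (n m : ℕ) (s : State) : Prop where
  input : s.arr 0 = x
  reg_zero : s.reg 0 = n
  reg_one : s.reg 1 = m
  reg_two : s.reg 2 = 1
  reg_three : s.reg 3 = n + 1
  reg_four : s.reg 4 = (n + 1) * (n + 1)
  reg_five : s.reg 5 = 2 + n * n

theorem Ready.congr {x : ℕ → ℕ} {n m : ℕ} {s s' : State} (h : Ready x n m s)
    (harr : s'.arr 0 = s.arr 0) (hreg : ∀ r < 6, s'.reg r = s.reg r) : Ready x n m s' where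
  input := by rw [harr, h.input]
  reg_zero := by rw [hreg 0 (by decide), h.reg_zero]
  reg_one := by rw [hreg 1 (by decide), h.reg_one]
  reg_two := by rw [hreg 2 (by decide), h.reg_two]
  reg_three := by rw [hreg 3 (by decide), h.reg_three]
  reg_four := by rw [hreg 4 (by decide), h.reg_four]
  reg_five := by rw [hreg 5 (by decide), h.reg_five]

/-- One round of the count of the neighbours that like the house. -/
def countRound : Program :=
  .seq (load 19 0 17) <|
  .seq (branch 19 (.seq (load 19 0 18) (branch 19 (add 13 13 4) skip)) skip) <|
  .seq (add 17 17 2) <|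
  .seq (add 18 18 1) <|
  sub 15 15 2

/-- `reg 13 :=` the cost plus the price of house `reg 11` for agent `reg 6`. -/
def evalHouse : Program :=
  .seq (mul 17 6 0) <|
  .seq (add 17 17 2) <|
  .seq (add 17 17 2) <|
  .seq (mul 18 6 1) <|
  .seq (add 18 18 11) <|
  .seq (add 18 18 5) <|
  .seq (load 19 0 18) <|
  .seq (const 13 0) <|
  .seq (branch 19 skip (add 13 13 3)) <|
  .seq (load 19 2 11) <|
  .seq (add 13 13 19) <|
  .seq (add 18 5 11) <|
  .seq (const 19 0) <|
  .seq (add 15 0 19) <|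
  loop 15 countRound

/-- `reg 9 :=` a house for which cost plus price for agent `reg 6` is minimum. -/
def findBest : Program :=
  .seq (const 11 0) <|
  .seq evalHouse <|
  .seq (const 9 0) <|
  .seq (add 10 13 9) <|
  .seq (const 11 1) <|
  .seq (sub 12 1 11) <|
  loop 12 <|
    .seq evalHouse <|
    .seq (sub 14 10 13) <|
    .seq (branch 14 (.seq (const 14 0) (.seq (add 9 11 14) (add 10 13 14))) skip) <|
    .seq (add 11 11 2) <|
    sub 12 1 11

/-- The agent `reg 6` bids for its best house; `reg 6` becomes the next unassigned agent, `reg 7`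
the number of agents processed, and `reg 8` the test value for the main loop. -/
def bidRound : Program :=
  .seq findBest <|
  .seq (load 16 2 9) <|
  .seq (add 16 16 2) <|
  .seq (store 2 9 16) <|
  .seq (store 1 6 9) <|
  .seq (load 16 3 9) <|
  .seq (add 17 6 2) <|
  .seq (store 3 9 17) <|
  .seq (branch 16 (sub 6 16 2) (.seq (add 7 7 2) (.seq (const 17 0) (add 6 7 17)))) <|
  sub 8 0 6

/-- Set up the constants. -/
def setup : Program :=
  .seq (const 2 1) <|
  .seq (load 0 0 16) <|
  .seq (load 1 0 2) <|
  .seq (add 3 0 2) <|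
  .seq (mul 4 3 3) <|
  .seq (mul 5 0 0) <|
  .seq (add 5 5 2) <|
  .seq (add 5 5 2) <|
  sub 8 0 6

/-- The auction algorithm. -/
def auction : Program := .seq setup (loop 8 bidRound)

variable {x : ℕ → ℕ} {n m N : ℕ} {s : State}

/-- In the counting loop, register `17` walks along the agent's row of the adjacency matrix in steps
of `1`, and register `18` down the house's column of the preference matrix in steps of `m`. -/
theorem runs_evalHouse (hs : Ready x n m s) (hn : n ≤ N) (hm : m ≤ N) :
    Runs evalHouse s fun t s' => t ≤ 15 * N + 30 ∧ s'.arr = s.arr ∧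
      s'.reg 13 = inputCost x n m (s.reg 6) (s.reg 11) + s.arr 2 (s.reg 11) ∧
      ∀ r < 13, s'.reg r = s.reg r := by
  obtain ⟨hx, h0, h1, h2, h3, h4, h5⟩ := hs
  rw [evalHouse, Runs.seq_iff]
  refine (Runs.mul h2 (by decide) (by decide) (by decide) (by decide) (by decide) N
    (by omega)).mono ?_
  rintro t₁ s₁ ⟨ht₁, harr₁, hv₁, hr₁⟩
  simp only [Runs.seq_iff, Runs.add_iff]
  refine (Runs.mul (N := N) ?_ (by decide) (by decide) (by decide) (by decide) (by decide)
    ?_).mono ?_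
  · simp [hr₁, h2]
  · simp [hr₁, h1, hm]
  rintro t₂ s₂ ⟨ht₂, harr₂, hv₂, hr₂⟩
  simp [hr₁, h0, h1, h2, hv₁] at hv₂
  have hv : s₂.reg 17 = 2 + s.reg 6 * n := by
    rw [hr₂ 17 (by decide) (by decide)]
    simp [hr₁, h0, h2, hv₁]; omega
  have hr : ∀ r < 13, s₂.reg r = s.reg r := by
    intro r hr
    rw [hr₂ r (by omega) (by omega)]
    simp [show r ≠ 17 by omega, hr₁ r (by omega) (by omega)]
  have harr : s₂.arr = s.arr := by rw [harr₂]; simpa using harr₁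
  clear hr₁ hr₂ harr₁ harr₂ hv₁
  generalize hcur : s.reg 6 = cur at *
  generalize hh : s.reg 11 = h at *
  have hr0 := hr 0 (by decide)
  have hr1 := hr 1 (by decide)
  have hr2 := hr 2 (by decide)
  have hr3 := hr 3 (by decide)
  have hr4 := hr 4 (by decide)
  have hr5 := hr 5 (by decide)
  have hr11 := hr 11 (by decide)
  have hadr : cur * m + h + (2 + n * n) = 2 + n * n + (cur * m + h) := add_comm _ _
  -- the loop, shared by the two cases of the branch before it
  have key : ∀ (s₃ : State) (c : ℕ), s₃.arr = s.arr → (∀ r < 13, s₃.reg r = s.reg r) →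
      s₃.reg 13 = c → s₃.reg 15 = n → s₃.reg 17 = 2 + cur * n → s₃.reg 18 = 2 + n * n + h →
      Runs (loop 15 countRound) s₃ fun t s' => t ≤ 9 * N + 1 ∧ s'.arr = s.arr ∧
        s'.reg 13 = c + (n + 1) * (n + 1) * Nat.count (fun a' => x (2 + cur * n + a') ≠ 0 ∧
          x (2 + n * n + (a' * m + h)) ≠ 0) n ∧ ∀ r < 13, s'.reg r = s.reg r := by
    intro s₃ c ha hrr h13 h15 h17 h18
    refine (Runs.loop_count n 8 (fun k s' => s'.reg 15 = n - k ∧ s'.arr = s.arr ∧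
      s'.reg 17 = 2 + cur * n + k ∧ s'.reg 18 = 2 + n * n + (k * m + h) ∧
      s'.reg 13 = c + (n + 1) * (n + 1) * Nat.count (fun a' => x (2 + cur * n + a') ≠ 0 ∧
          x (2 + n * n + (a' * m + h)) ≠ 0) k ∧ ∀ r < 13, s'.reg r = s.reg r)
      (fun _ _ h => h.1) ?_ ?_).mono ?_
    · rintro k hk s' ⟨g15, ga, g17, g18, g13, gr⟩
      have gr1 := gr 1 (by decide)
      have gr2 := gr 2 (by decide)
      have gr4 := gr 4 (by decide)
      simp only [countRound, Runs.seq_iff, Runs.load_iff, Runs.branch_iff, Runs.add_iff,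
        Runs.sub_iff, Runs.skip_iff]
      by_cases hA : x (2 + cur * n + k) = 0
      · simp [Nat.count_succ, ga, hx, g15, g17, g18, g13, gr1, gr2, h1, h2, hA]
        refine ⟨by omega, by omega, by ring, ?_⟩
        intro r hr
        simp [show r ≠ 15 by omega, show r ≠ 17 by omega, show r ≠ 18 by omega,
          show r ≠ 19 by omega, gr r hr]
      · by_cases hB : x (2 + n * n + (k * m + h)) = 0
        · simp [Nat.count_succ, ga, hx, g15, g17, g18, g13, gr1, gr2, h1, h2, hA, hB]
          refine ⟨by omega, by omega, by ring, ?_⟩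
          intro r hr
          simp [show r ≠ 15 by omega, show r ≠ 17 by omega, show r ≠ 18 by omega,
            show r ≠ 19 by omega, gr r hr]
        · simp [Nat.count_succ, ga, hx, g15, g17, g18, g13, gr1, gr2, gr4, h1, h2, h4, hA, hB]
          refine ⟨by omega, by omega, by ring, by ring, ?_⟩
          intro r hr
          simp [show r ≠ 15 by omega, show r ≠ 17 by omega, show r ≠ 18 by omega,
            show r ≠ 13 by omega, show r ≠ 19 by omega, gr r hr]
    · exact ⟨by simpa using h15, ha, by simpa using h17, by simpa using h18, by simpa using h13, hrr⟩
    · rintro t s' ⟨ht, -, ga, -, -, g13, gr⟩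
      exact ⟨by omega, ga, g13, gr⟩
  simp only [Runs.add_iff, Runs.load_iff, Runs.const_iff, Runs.branch_iff, Runs.skip_iff]
  split_ifs with hb
  · refine (key _ (n + 1 + s.arr 2 h) ?_ ?_ ?_ ?_ ?_ ?_).mono ?_
    · simpa using harr
    · intro r hr'
      simp [show r ≠ 13 by omega, show r ≠ 15 by omega, show r ≠ 18 by omega,
            show r ≠ 19 by omega, hr r hr']
    · simp [harr, hr3, h3, hr11, hh]
    · simp [hr0, h0]
    · simp [hv]
    · simp [hr5, h5, hr11, hh]
    · rintro t s' ⟨ht, ga, g13, gr⟩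
      simp [harr, hx, hv₂, hr11, hh, hr5, h5, hadr] at hb
      refine ⟨by omega, ga, ?_, gr⟩
      rw [g13, inputCost, if_pos hb]; ring
  · refine (key _ (s.arr 2 h) ?_ ?_ ?_ ?_ ?_ ?_).mono ?_
    · simpa using harr
    · intro r hr'
      simp [show r ≠ 13 by omega, show r ≠ 15 by omega, show r ≠ 18 by omega,
            show r ≠ 19 by omega, hr r hr']
    · simp [harr, hr11, hh]
    · simp [hr0, h0]
    · simp [hv]
    · simp [hr5, h5, hr11, hh]
    · rintro t s' ⟨ht, ga, g13, gr⟩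
      simp [harr, hx, hv₂, hr11, hh, hr5, h5, hadr] at hb
      refine ⟨by omega, ga, ?_, gr⟩
      rw [g13, inputCost, if_neg hb]; ring

theorem runs_findBest (hs : Ready x n m s) (hn : n ≤ N) (hm : m ≤ N) (hm0 : 0 < m) :
    Runs findBest s fun t s' => t ≤ (N + 1) * (15 * N + 40) ∧ s'.arr = s.arr ∧
      (∀ r < 9, s'.reg r = s.reg r) ∧ s'.reg 9 < m ∧
      ∀ h < m, inputCost x n m (s.reg 6) (s'.reg 9) + s.arr 2 (s'.reg 9) ≤
        inputCost x n m (s.reg 6) h + s.arr 2 h := by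
  simp only [findBest, Runs.seq_iff, Runs.const_iff]
  refine (runs_evalHouse (x := x) (n := n) (m := m) (N := N) (s := s.setReg 11 0)
    (hs.congr rfl ?_) hn hm).mono ?_
  · intro r hr
    simp [show r ≠ 11 by omega]
  rintro t₁ s₁ ⟨ht₁, ha₁, hv₁, hr₁⟩
  simp only [Runs.add_iff, Runs.sub_iff]
  simp at ha₁ hv₁
  have hr₁' : ∀ r < 9, s₁.reg r = s.reg r := by
    intro r hr
    rw [hr₁ r (by omega)]
    simp [show r ≠ 11 by omega]
  have hs1 : s₁.reg 1 = m := by rw [hr₁' 1 (by decide), hs.reg_one]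
  set cost : ℕ → ℕ := fun h => inputCost x n m (s.reg 6) h + s.arr 2 h with hcost
  -- House `0` is evaluated before the loop, so `m - 1` rounds remain, and after `k` of them the
  -- minimum covers the houses `0, …, k`.
  refine (Runs.loop_count (m - 1) (15 * N + 38) (fun k s' => s'.reg 12 = m - 1 - k ∧
      s'.reg 11 = k + 1 ∧ s'.arr = s.arr ∧ (∀ r < 9, s'.reg r = s.reg r) ∧ s'.reg 9 < m ∧
      s'.reg 10 = cost (s'.reg 9) ∧ ∀ h ≤ k, s'.reg 10 ≤ cost h)
      (fun _ _ h => h.1) ?_ ?_).mono ?_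
  · rintro k hk s' ⟨g12, g11, ga, gr, g9, g10, gmin⟩
    simp only [Runs.seq_iff]
    refine (runs_evalHouse (x := x) (n := n) (m := m) (N := N)
      (hs.congr (by rw [ga]) fun r hr => gr r (by omega)) hn hm).mono ?_
    rintro t₂ s₂ ⟨ht₂, ha₂, hv₂, hr₂⟩
    rw [gr 6 (by decide), ga, g11] at hv₂
    have hr1 : s₂.reg 1 = m := by rw [hr₂ 1 (by decide), gr 1 (by decide), hs.reg_one]
    have hr2 : s₂.reg 2 = 1 := by rw [hr₂ 2 (by decide), gr 2 (by decide), hs.reg_two]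
    have hr9 := hr₂ 9 (by decide)
    have hr10 := hr₂ 10 (by decide)
    have hr11 := hr₂ 11 (by decide)
    rw [g11] at hr11
    have hrr : ∀ r < 9, s₂.reg r = s.reg r := fun r hr => by rw [hr₂ r (by omega), gr r hr]
    change s₂.reg 13 = cost (k + 1) at hv₂
    simp only [Runs.seq_iff, Runs.add_iff, Runs.sub_iff, Runs.branch_iff, Runs.const_iff,
      Runs.skip_iff]
    -- The truncated difference is nonzero exactly when the new house is strictly better.
    split_ifs with hb
    · simp [hr10, hv₂] at hb
      refine ⟨by omega, ?_, ?_, ?_, ?_, ?_, ?_, ?_⟩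
      · simp [hr1, hr2, hr11]; omega
      · simp [hr2, hr11]
      · simp [ha₂, ga]
      · intro r hr
        simp [show r ≠ 12 by omega, show r ≠ 11 by omega, show r ≠ 14 by omega, hrr r hr]
      · simpa [hr9] using g9
      · simpa [hr9, hr10] using g10
      · intro h hh
        simp only [State.setReg_reg]
        simp [hr10]
        rcases Nat.le_succ_iff.1 hh with hh | rfl
        · exact gmin h hh
        · exact Nat.sub_eq_zero_iff_le.1 hb
    · have hb' : cost (k + 1) < s'.reg 10 := by
        simp [hr10, hv₂] at hb; omega
      refine ⟨by omega, ?_, ?_, ?_, ?_, ?_, ?_, ?_⟩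
      · simp [hr1, hr2, hr11]; omega
      · simp [hr2, hr11]
      · simp [ha₂, ga]
      · intro r hr
        simp [show r ≠ 9 by omega, show r ≠ 10 by omega, show r ≠ 12 by omega,
          show r ≠ 11 by omega, show r ≠ 14 by omega, hrr r hr]
      · simp [hr11]; omega
      · simp [hr11, hv₂]
      · intro h hh
        simp [hv₂]
        rcases Nat.le_succ_iff.1 hh with hh | rfl
        · exact hb'.le.trans (gmin h hh)
        · exact le_rfl
  · refine ⟨?_, ?_, ?_, ?_, ?_, ?_, ?_⟩
    · simp [hs1]
    · simp
    · simp [ha₁]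
    · intro r hr
      simp [show r ≠ 9 by omega, show r ≠ 10 by omega, show r ≠ 12 by omega,
          show r ≠ 11 by omega, hr₁' r hr]
    · simpa using hm0
    · simp [hv₁, hcost]
    · intro h hh
      obtain rfl : h = 0 := by omega
      simp [hv₁, hcost]
  · rintro t s' ⟨ht, -, -, ga, gr, g9, g10, gmin⟩
    refine ⟨?_, ga, gr, g9, fun h hh => ?_⟩
    · have : (m - 1) * (15 * N + 38 + 1) ≤ N * (15 * N + 39) := by
        gcongr; omega
      nlinarith
    · have := gmin h (by omega)
      rw [g10] at this
      exact this

theorem runs_bidRound (hs : Ready x n m s) (hn : n ≤ N) (hm : m ≤ N) (hnm : n ≤ m)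
    (hI : AuctionInv n m ((n + 1) ^ 3) (inputCost x n m) (s.arr 1) (s.arr 2) (s.arr 3) (s.reg 6)
      (s.reg 7)) (hcur : s.reg 6 < n) :
    Runs bidRound s fun t s' => t ≤ (N + 1) * (15 * N + 40) + 13 ∧ Ready x n m s' ∧
      AuctionInv n m ((n + 1) ^ 3) (inputCost x n m) (s'.arr 1) (s'.arr 2) (s'.arr 3) (s'.reg 6)
        (s'.reg 7) ∧ s'.reg 8 = n - s'.reg 6 ∧
      ∃ b < m, s'.arr 2 = Function.update (s.arr 2) b (s.arr 2 b + 1) := by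
  rw [bidRound, Runs.seq_iff]
  refine (runs_findBest (N := N) hs hn hm (by omega)).mono ?_
  rintro t₁ s₁ ⟨ht₁, ha₁, hr₁, hb, hbest⟩
  obtain ⟨hkick, hfree⟩ := hI.bid hnm hcur (fun a _ h _ => inputCost_le x n m a h) hb hbest
  have hr0 := hr₁ 0 (by decide)
  have hr2 := hr₁ 2 (by decide)
  have hr6 := hr₁ 6 (by decide)
  have hr7 := hr₁ 7 (by decide)
  rw [hs.reg_zero] at hr0
  rw [hs.reg_two] at hr2
  generalize hb9 : s₁.reg 9 = b at *
  simp only [Runs.seq_iff, Runs.add_iff, Runs.sub_iff, Runs.load_iff, Runs.store_iff,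
    Runs.const_iff, Runs.branch_iff]
  simp only [State.setReg_reg, State.setReg_arr, State.setArr_reg, State.setArr_arr]
  simp [hb9, hr0, hr2, hr6, hr7, ha₁]
  have hready : ∀ s' : State, s'.arr 0 = s.arr 0 → (∀ r < 6, s'.reg r = s₁.reg r) →
      Ready x n m s' := fun s' h h' => hs.congr h fun r hr => by
    rw [h' r hr, hr₁ r (by omega)]
  -- The old entry of `own` is `0` for a free house; otherwise it is the successor of the displaced
  -- agent, who bids next.
  split_ifs with h0
  · refine ⟨by omega, hready _ (by simp [ha₁]) ?_, hfree h0, b, hb, rfl⟩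
    intro r hr
    simp [show r ≠ 6 by omega, show r ≠ 7 by omega, show r ≠ 8 by omega, show r ≠ 16 by omega,
      show r ≠ 17 by omega]
  · refine ⟨by omega, hready _ (by simp [ha₁]) ?_, hkick _ (by omega), b, hb, rfl⟩
    intro r hr
    simp [show r ≠ 6 by omega, show r ≠ 8 by omega, show r ≠ 16 by omega,
      show r ≠ 17 by omega]

theorem runs_setup (hx : s.arr 0 = x) (hx0 : x 0 = n) (hx1 : x 1 = m) (hs : ∀ r, s.reg r = 0)
    (hn : n ≤ N) :
    Runs setup s fun t s' => t ≤ 6 * N + 16 ∧ Ready x n m s' ∧ s'.arr = s.arr ∧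
      s'.reg 6 = 0 ∧ s'.reg 7 = 0 ∧ s'.reg 8 = n := by
  simp only [setup, Runs.seq_iff, Runs.add_iff, Runs.load_iff, Runs.const_iff]
  refine (Runs.mul (N := N + 1) ?_ (by decide) (by decide) (by decide) (by decide) (by decide)
    ?_).mono ?_
  · simp
  · simp [hs, hx, hx0, hn]
  rintro t₁ s₁ ⟨ht₁, ha₁, hv₁, hr₁⟩
  refine (Runs.mul (N := N) ?_ (by decide) (by decide) (by decide) (by decide) (by decide)
    ?_).mono ?_
  · simp [hr₁]
  · simp [hr₁, hs, hx, hx0, hn]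
  rintro t₂ s₂ ⟨ht₂, ha₂, hv₂, hr₂⟩
  simp [hr₁, hs, hx, hx0] at hv₂
  simp [hs, hx, hx0] at hv₁
  simp only [Runs.sub_iff]
  refine ⟨by omega, ⟨?_, ?_, ?_, ?_, ?_, ?_, ?_⟩, ?_, ?_, ?_, ?_⟩
  · simp [ha₂, ha₁, hx]
  · simp [hr₂, hr₁, hs, hx, hx0]
  · simp [hr₂, hr₁, hx, hx1]
  · simp [hr₂, hr₁]
  · simp [hr₂, hr₁, hs, hx, hx0]
  · simp [hr₂, hv₁]
  · simp [hr₂, hr₁, hv₂]; omega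
  · simp [ha₂, ha₁]
  · simp [hr₂, hr₁, hs]
  · simp [hr₂, hr₁, hs]
  · simp [hr₂, hr₁, hs, hx, hx0]

/-- A bound for the running time of the auction. -/
def auctionTime (N : ℕ) : ℕ :=
  6 * N + 17 + N * ((N + 1) ^ 3 + 1) * ((N + 1) * (15 * N + 40) + 14)

theorem runs_auction (hx : s.arr 0 = x) (hx0 : x 0 = n) (hx1 : x 1 = m) (hs : ∀ r, s.reg r = 0)
    (harr : ∀ b ≠ 0, ∀ k, s.arr b k = 0) (hnm : n ≤ m) (hm : m ≤ N) :
    Runs auction s fun t s' => t ≤ auctionTime N ∧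
      ∃ ψ : Fin n ↪ Fin m, (∀ a : Fin n, s'.arr 1 a = ψ a) ∧
        ∀ χ : Fin n ↪ Fin m, ∑ a : Fin n, inputCost x n m a (ψ a) ≤
          ∑ a : Fin n, inputCost x n m a (χ a) + n := by
  have hn : n ≤ N := hnm.trans hm
  rw [auction, Runs.seq_iff]
  refine (runs_setup hx hx0 hx1 hs hn).mono ?_
  rintro t₁ s₁ ⟨ht₁, hready, ha₁, h6, h7, h8⟩
  rcases Nat.eq_zero_or_pos n with rfl | hpos
  · refine ⟨1, s₁, .loop_done h8, ?_, ⟨⟨Fin.elim0, fun a => a.elim0⟩, fun a => a.elim0, ?_⟩⟩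
    · simp only [auctionTime]; omega
    · simp
  set D := (n + 1) ^ 3 + 1 with hD
  -- The variant is the room left for price increases, since no price exceeds `D`.
  refine (Runs.loop (fun s => m * D - ∑ h ∈ Finset.range m, s.arr 2 h)
    ((N + 1) * (15 * N + 40) + 13) (fun s => Ready x n m s ∧
      AuctionInv n m ((n + 1) ^ 3) (inputCost x n m) (s.arr 1) (s.arr 2) (s.arr 3) (s.reg 6)
        (s.reg 7) ∧ s.reg 8 = n - s.reg 6) ?_ ?_).mono ?_
  · rintro s ⟨hr, hI, h8⟩ h80
    refine (runs_bidRound (N := N) hr hn hm hnm hI (by omega)).mono ?_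
    rintro t s' ⟨ht, hr', hI', h8', b, hb, hp⟩
    refine ⟨ht, ⟨hr', hI', h8'⟩, ?_⟩
    -- The bound after the bid is what makes the truncated difference drop strictly.
    have hle : ∑ h ∈ Finset.range m, s'.arr 2 h ≤ m * D := by
      simpa using Finset.sum_le_card_nsmul (Finset.range m) _ D
        fun h hh => hI'.price_le h (by simpa using hh)
    have hlt : ∑ h ∈ Finset.range m, s.arr 2 h < ∑ h ∈ Finset.range m, s'.arr 2 h := by
      rw [hp]
      refine Finset.sum_lt_sum (fun h _ => ?_) ⟨b, by simpa using hb, by simp⟩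
      rcases eq_or_ne h b with rfl | hne
      · simp
      · simp [hne]
    omega
  · refine ⟨hready, ?_, by rw [h8, h6, Nat.sub_zero]⟩
    rw [h6, h7, ha₁]
    exact AuctionInv.initial hpos (harr 3 (by decide)) (harr 2 (by decide))
  · rintro t s' ⟨ht, ⟨-, hI, h8'⟩, h80⟩
    refine ⟨?_, hI.optimal (by omega)⟩
    have h1 : (m * D - ∑ h ∈ Finset.range m, s₁.arr 2 h) * ((N + 1) * (15 * N + 40) + 13 + 1) ≤
        N * ((N + 1) ^ 3 + 1) * ((N + 1) * (15 * N + 40) + 14) := by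
      refine Nat.mul_le_mul ((Nat.sub_le _ _).trans ?_) le_rfl
      rw [hD]; gcongr
    unfold auctionTime
    omega

end HouseAllocation

/-! ### Reading the encoding, and envy as a matching cost -/

namespace HouseAllocation

open RAM

namespace Network

variable (I : Network)

theorem encode_zero : I.encode.getD 0 0 = I.n := by simp [encode]

theorem encode_one : I.encode.getD 1 0 = I.m := by simp [encode]

-- The row-major position is the image of the pair under `finProdFinEquiv`, whose inverse is given
-- by `divNat` and `modNat`, as in `encode`.
open Classical in
theorem encode_adj (a a' : Fin I.n) :
    I.encode.getD (2 + a * I.n + a') 0 = if I.G.Adj a a' then 1 else 0 := by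
  have hlt : (a : ℕ) * I.n + a' < I.n * I.n := by
    have := a.2; have := a'.2; nlinarith
  have hk : (⟨a * I.n + a', hlt⟩ : Fin (I.n * I.n)) = finProdFinEquiv (a, a') :=
    Fin.ext (by simp; ring)
  have h1 := Equiv.symm_apply_apply finProdFinEquiv (a, a')
  rw [← hk, finProdFinEquiv_symm_apply, Prod.mk.injEq] at h1
  rw [encode, List.getD_append _ _ _ _ (by simp; omega),
    List.getD_append_right _ _ _ _ (by simp; omega), List.getD_eq_getElem _ _ (by simp; omega), List.getElem_ofFn]
  have : ∀ h, (⟨2 + ↑a * I.n + ↑a' - [I.n, I.m].length, h⟩ : Fin (I.n * I.n)) =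
      ⟨a * I.n + a', hlt⟩ := fun h => Fin.ext (by simp; omega)
  simp only [this, h1]

open Classical in
theorem encode_pref (a : Fin I.n) (h : Fin I.m) :
    I.encode.getD (2 + I.n * I.n + (a * I.m + h)) 0 = if h ∈ I.pref a then 1 else 0 := by
  have hlt : (a : ℕ) * I.m + h < I.n * I.m := by
    have := a.2; have := h.2; nlinarith
  have hk : (⟨a * I.m + h, hlt⟩ : Fin (I.n * I.m)) = finProdFinEquiv (a, h) :=
    Fin.ext (by simp; ring)
  have h1 := Equiv.symm_apply_apply finProdFinEquiv (a, h)
  rw [← hk, finProdFinEquiv_symm_apply, Prod.mk.injEq] at h1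
  rw [encode, List.getD_append_right _ _ _ _ (by simp; omega),
    List.getD_eq_getElem _ _ (by simp; omega), List.getElem_ofFn]
  have : ∀ h', (⟨2 + I.n * I.n + (↑a * I.m + ↑h) - ([I.n, I.m] ++ List.ofFn fun k : Fin (I.n * I.n) =>
      if I.G.Adj k.divNat k.modNat then 1 else 0).length, h'⟩ : Fin (I.n * I.m)) =
      ⟨a * I.m + h, hlt⟩ := fun h => Fin.ext (by simp; omega)
  simp only [this, h1]

variable {I}

theorem pref_eq_singleton (hI : ∀ a, (I.pref a).card = 1) (a : Fin I.n) (h : Fin I.m) :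
    I.pref a = {h} ↔ h ∈ I.pref a := by
  obtain ⟨b, hb⟩ := Finset.card_eq_one.1 (hI a)
  rw [hb, Finset.singleton_inj, Finset.mem_singleton, eq_comm]

/-- If every agent likes one house, then the scaled cost is the scaled and shifted weight. -/
theorem inputCost_encode (hI : ∀ a, (I.pref a).card = 1) (a : Fin I.n) (h : Fin I.m) :
    (inputCost (fun k => I.encode.getD k 0) I.n I.m a h : ℚ) =
      ((I.n : ℚ) + 1) * ((I.n + 1) * I.weight a h + 1) := by
  classical
  have hcount : Nat.count (fun a' => I.encode.getD (2 + a * I.n + a') 0 ≠ 0 ∧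
      I.encode.getD (2 + I.n * I.n + (a' * I.m + h)) 0 ≠ 0) I.n =
      {a' | I.G.Adj a a' ∧ I.pref a' = {h}}.ncard := by
    rw [Nat.count_eq_card_filter_range, Set.ncard_eq_toFinset_card']
    symm
    refine Finset.card_bij (fun a' _ => (a' : ℕ)) ?_ ?_ ?_
    · intro a' ha'
      simp only [Set.mem_toFinset, Set.mem_ofPred_eq] at ha'
      simp [encode_adj, encode_pref, -List.getD_eq_getElem?_getD, ha'.1, ha'.2]
    · exact fun _ _ _ _ h => Fin.ext h
    · intro k hk
      simp only [Finset.mem_filter, Finset.mem_range] at hk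
      obtain ⟨hkn, hk⟩ := hk
      lift k to Fin I.n using hkn
      rw [encode_adj, encode_pref] at hk
      exact ⟨k, by simpa [pref_eq_singleton hI] using hk, rfl⟩
  have hn : (I.n : ℚ) + 1 ≠ 0 := by positivity
  rw [inputCost, hcount, encode_pref, weight]
  by_cases hh : h ∈ I.pref a
  · simp [hh]; field_simp; ring
  · simp [hh]; ring

/-- The shift that makes the costs nonnegative contributes `(n + 1) * n` to every allocation, so it
does not affect comparisons. -/
theorem sum_inputCost (hI : ∀ a, (I.pref a).card = 1) (φ : I.Allocation) :
    ((∑ a : Fin I.n, inputCost (fun k => I.encode.getD k 0) I.n I.m a (φ a) : ℕ) : ℚ) =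
      ((I.n : ℚ) + 1) * ((I.n + 1) * I.cost φ + I.n) := by
  push_cast
  simp only [inputCost_encode hI, ← Finset.mul_sum, Finset.sum_add_distrib, cost]
  simp

/-- The number of agents that envy a neighbour is the number of pairs of an agent and a neighbour
who likes the agent's house. -/
theorem sum_ncard_eq_envy (hI : ∀ a, (I.pref a).card = 1) (φ : I.Allocation) :
    ∑ a, {a' | I.G.Adj a a' ∧ I.pref a' = {φ a}}.ncard = I.envy φ := by
  classical
  have h1 : ∀ a, {a' | I.G.Adj a a' ∧ I.pref a' = {φ a}}.ncard =
      ∑ a', if I.G.Adj a a' ∧ φ a ∈ I.pref a' then 1 else 0 := fun a => by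
    rw [Set.ncard_eq_toFinset_card', ← Finset.card_filter]
    congr 1
    ext a'
    simp [pref_eq_singleton hI]
  have h2 : I.envy φ = ∑ a', if (I.enviedBy φ a').Nonempty then 1 else 0 := by
    rw [envy, Set.ncard_eq_toFinset_card', ← Finset.card_filter]
    congr 1
    ext a'
    simp
  simp only [h1, h2]
  -- The pairs are now grouped by the agent `a'` who may envy; each group has at most one element,
  -- as only one agent can hold the house that `a'` likes.
  rw [Finset.sum_comm]
  refine Finset.sum_congr rfl fun a' _ => ?_
  obtain ⟨b, hb⟩ := Finset.card_eq_one.1 (hI a')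
  rw [← Finset.card_filter]
  split_ifs with h
  · obtain ⟨a, ha, -, ha'⟩ := h
    rw [Finset.card_eq_one]
    refine ⟨a, ?_⟩
    ext c
    simp only [hb, Finset.mem_singleton, Finset.mem_filter, Finset.mem_univ, true_and] at ha' ⊢
    constructor
    · rintro ⟨-, hc⟩
      exact φ.injective (hc.trans ha'.symm)
    · rintro rfl
      exact ⟨ha.symm, ha'⟩
  · rw [Finset.card_eq_zero, Finset.filter_eq_empty_iff]
    rintro a - ⟨ha, ha'⟩
    -- If `a'` itself held its liked house, then `a = a'`, but a graph has no loops.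
    refine h ⟨a, ha.symm, fun hself => ha.ne ?_, ha'⟩
    rw [hb, Finset.mem_singleton] at hself ha'
    exact φ.injective (ha'.trans hself.symm)

theorem cost_eq (hI : ∀ a, (I.pref a).card = 1) (φ : I.Allocation) :
    I.cost φ = (I.envy φ : ℚ) - (I.happiness φ : ℚ) * (1 / ((I.n : ℚ) + 1)) := by
  classical
  have h : (I.happiness φ : ℚ) = ∑ a, if φ a ∈ I.pref a then 1 else 0 := by
    rw [happiness, Set.ncard_eq_toFinset_card', Finset.sum_boole]
    simp
  rw [cost, ← sum_ncard_eq_envy hI, h, Finset.sum_mul]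
  simp [weight, Finset.sum_sub_distrib]

theorem happiness_le (φ : I.Allocation) : I.happiness φ ≤ I.n := by
  simpa [happiness] using Set.ncard_le_card {a | φ a ∈ I.pref a}

/-- After multiplication by `n + 1`, one unit of envy weighs `n + 1`, more than any difference in
happiness, so the order is lexicographic. -/
theorem cost_le_cost_iff (hI : ∀ a, (I.pref a).card = 1) (φ ψ : I.Allocation) :
    I.cost φ ≤ I.cost ψ ↔
      I.envy φ < I.envy ψ ∨ I.envy φ = I.envy ψ ∧ I.happiness ψ ≤ I.happiness φ := by
  have hφ := happiness_le φ
  have hψ := happiness_le ψ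
  have hn : (0 : ℚ) < (I.n : ℚ) + 1 := by positivity
  have h1 : I.cost φ ≤ I.cost ψ ↔
      (I.n + 1) * I.envy φ + I.happiness ψ ≤ (I.n + 1) * I.envy ψ + I.happiness φ := by
    rw [cost_eq hI, cost_eq hI, ← mul_le_mul_iff_right₀ hn, ← Nat.cast_le (α := ℚ)]
    have h : ∀ e k : ℚ, ((I.n : ℚ) + 1) * (e - k * (1 / ((I.n : ℚ) + 1))) =
        ((I.n : ℚ) + 1) * e - k := fun e k => by field_simp
    rw [h, h]
    push_cast
    constructor <;> intro h <;> linarith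
  rw [h1]
  rcases lt_trichotomy (I.envy φ) (I.envy ψ) with h | h | h
  · simp only [h, true_or, iff_true]
    nlinarith
  · simp [h]
  · simp only [h.not_gt, h.ne', false_and, or_self, iff_false, not_le]
    nlinarith

theorem isOptimallyHappy_iff (hI : ∀ a, (I.pref a).card = 1) (φ : I.Allocation) :
    I.IsOptimallyHappy φ ↔ ∀ ψ : I.Allocation, I.cost φ ≤ I.cost ψ := by
  simp only [cost_le_cost_iff hI]
  constructor
  · rintro ⟨hmin, hmax⟩ ψ
    rcases (hmin ψ).lt_or_eq with h | h
    · exact Or.inl h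
    · exact Or.inr ⟨h, hmax ψ fun χ => h ▸ hmin χ⟩
  · intro h
    refine ⟨fun ψ => ?_, fun ψ hψ => ?_⟩
    · rcases h ψ with h | h
      · exact h.le
      · exact h.1.le
    · rcases h ψ with h | h
      · exact absurd (hψ φ) (by omega)
      · exact h.2

end Network

/-- One factor `n + 1` in the scaled cost clears the denominator; the second separates distinct
values by more than the auction's error `n`. -/
theorem solvesWithin_auction (I : Network) (hnm : I.n ≤ I.m) (hI : ∀ a, (I.pref a).card = 1) :
    SolvesWithin auction I (auctionTime (I.n + I.m)) := by
  obtain ⟨t, s, he, ht, φ, hφ, hopt⟩ := runs_auction (s := init I.encode) (N := I.n + I.m)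
    (x := fun k => I.encode.getD k 0) (by simp [init]) I.encode_zero I.encode_one
    (by simp [init]) (fun b hb k => by simp [init, hb]) hnm (by omega)
  refine ⟨t, s, he, ht, φ, hφ, (Network.isOptimallyHappy_iff hI φ).2 fun ψ => ?_⟩
  have h1 : ((I.n : ℚ) + 1) * ((I.n + 1) * I.cost φ + I.n) ≤
      ((I.n : ℚ) + 1) * ((I.n + 1) * I.cost ψ + I.n) + I.n := by
    rw [← Network.sum_inputCost hI, ← Network.sum_inputCost hI]
    exact_mod_cast hopt ψ
  -- the scaled costs are integers
  have h2 : ∀ χ : I.Allocation, ((I.n : ℚ) + 1) * I.cost χ =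
      (((I.n + 1) * I.envy χ - I.happiness χ : ℤ) : ℚ) := fun χ => by
    rw [Network.cost_eq hI]
    push_cast
    field_simp
  have hn : (0 : ℚ) < (I.n : ℚ) + 1 := by positivity
  rw [← mul_le_mul_iff_right₀ hn]
  rw [h2, h2] at h1
  rw [h2, h2]
  generalize ((I.n + 1) * I.envy φ - I.happiness φ : ℤ) = u at *
  generalize ((I.n + 1) * I.envy ψ - I.happiness ψ : ℤ) = v at *
  norm_cast at h1 ⊢
  push_cast at h1
  -- If `v + 1 ≤ u`, then `h1` would give `n + 1 ≤ n`.
  by_contra! huv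
  nlinarith

end HouseAllocation

theorem mainTheorem4 :
    (∃ (P : RAM.Program) (p : Polynomial ℕ), ∀ I : HouseAllocation.Network,
      I.n ≤ I.m → (∀ a : Fin I.n, (I.pref a).card = 1) →
        HouseAllocation.SolvesWithin P I (p.eval (I.n + I.m))) ∧
    (∀ I : HouseAllocation.Network, (∀ a : Fin I.n, (I.pref a).card = 1) →
      ∀ φ : I.Allocation,
        I.cost φ = (I.envy φ : ℚ) - (I.happiness φ : ℚ) * (1 / ((I.n : ℚ) + 1)) ∧
        (I.IsOptimallyHappy φ ↔ ∀ ψ : I.Allocation, I.cost φ ≤ I.cost ψ)) := by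
  refine ⟨⟨HouseAllocation.auction, 6 * .X + 17 + .X * ((.X + 1) ^ 3 + 1) *
    ((.X + 1) * (15 * .X + 40) + 14), fun I hnm hI => ?_⟩, fun I hI φ =>
    ⟨HouseAllocation.Network.cost_eq hI φ, HouseAllocation.Network.isOptimallyHappy_iff hI φ⟩⟩
  have := HouseAllocation.solvesWithin_auction I hnm hI
  simpa [HouseAllocation.auctionTime] using this
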